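/- Let $\mathcal S$ be a closed subsemigroup of a locally compact (Hausdorff) group $\mathcal G$ with left-invariant Haar measure $\lambda$, and let $\mathcal S$ act on a non-empty compact Hausdorff space $K$ such that $\mathcal S\times K\to K$, $(s,x)\mapsto sx$, is continuous. A *Følner sequence* for $\mathcal S$ is a sequence $(F_n)_{n\in\mathbb N}$ of compact subsets of $\mathcal S$ with $\lambda(F_n)>0$ and $$\lim_{n\to\infty}\frac{\lambda(F_n\,\Delta\, sF_n)}{\lambda(F_n)}=0\quad\text{for every } s\in\mathcal S;$$ assume that one exists and fix it. Let $\mathscr S=\{T_s\mid s\in\mathcal S\}$ be the Koopman semigroup on the space $\mathrm C(K)$ of complex-valued continuous functions, $T_sf(x)=f(sx)$. A regular Borel probability measure $\mu$ on $K$ is *invariant* if $\int T f\,d\mu=\int f\,d\mu$ for all $T\in\mathscr S$, $f\in \mathrm C(K)$. Each $T\in\mathscr S$ then induces a bounded operator $T_\mu$ on $\mathrm L^1(K,\mu)$, and $\mu$ is *ergodic* if it is invariant and $\{g\in \mathrm L^1(K,\mu)\mid T_\mu g=g \text{ for all } T\in\mathscr S\}$ is one-dimensional. An *$\mathscr S$-ideal*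 is a closed proper ideal $I$ of $\mathrm C(K)$ with $TI\subset I$ for all $T\in\mathscr S$; it is *primitive* if $I=I_\mu:=\{f\in \mathrm C(K)\mid \int|f|\,d\mu=0\}$ for some ergodic measure $\mu$. Let $\mathrm{rad}_{\mathscr S}(0)$ be the intersection of all primitive $\mathscr S$-ideals. For $L\subset K$ put $I_L:=\{f\in \mathrm C(K)\mid f|_L=0\}$. The *support* $\operatorname{supp} I$ of an $\mathscr S$-ideal $I$ is the unique set $L$ with $I_L=I$ that is *self-supporting*, i.e. non-empty, closed and such that for all $x\in L$ and $T\in\mathscr S$ the measure $T'\delta_x$ has support in $L$. A closed non-empty set $L\subset K$ is a *center of attraction* (with respect to $(F_n)$) if for each open set $U\supset L$ and every $x\in K$ $$\lim_{n\to\infty}\frac{\lambda(\{s\in F_n\mid sx\in U\})}{\lambda(F_n)}=1 .$$ Then: 1. The notion of a center of attraction does not depend on the Følner sequence: any two Følner sequences for $\mathcal S$ have the same centers of attraction. 2. A closed non-empty set $L\subset K$ is a center of attraction if and only if $I_L\subset\mathrm{rad}_{\mathscr S}(0)$. 3. There is a unique minimal center of attraction $\mathrm M(\mathscr S)$ (with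 respect to inclusion); it is contained in every center of attraction, and it is the closure of the union of the supports of the ergodic measures. Moreover $\mathrm{rad}_{\mathscr S}(0)$ is an $\mathscr S$-ideal and $\mathrm M(\mathscr S)=\operatorname{supp}\mathrm{rad}_{\mathscr S}(0)$. -/

import Mathlib

open MeasureTheory Topology Filter
open scoped Pointwise symmDiff

noncomputable section

section MarkovSemigroups

variable {K : Type*} [TopologicalSpace K] [CompactSpace K]

/-- An `𝒮`-ideal: a closed proper ideal of `C(K)` that is invariant under all operators in `𝒮`. -/
structure IsSIdeal (𝒮 : Set (C(K, ℂ) →L[ℂ] C(K, ℂ))) (I : Ideal C(K, ℂ)) : Prop where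
  isClosed : IsClosed (I : Set C(K, ℂ))
  ne_top : I ≠ ⊤
  invariant : ∀ T ∈ 𝒮, ∀ f ∈ I, T f ∈ I

/-- The ideal `I_L` of all continuous functions on `K` vanishing on `L`. -/
def vanishingIdeal (L : Set K) : Ideal C(K, ℂ) where
  carrier := {f | ∀ x ∈ L, f x = 0}
  add_mem' := by
    intro f g hf hg x hx
    simp [hf x hx, hg x hx]
  zero_mem' := by
    intro x _
    simp
  smul_mem' := by
    intro c f hf x hx
    simp [hf x hx]

variable [MeasurableSpace K] [BorelSpace K]

/-- `P_𝒮(K)`: the regular Borel probability measures `μ` on `K` with `T'μ = μ` for all `T ∈ 𝒮`. -/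
def invariantMeasures (𝒮 : Set (C(K, ℂ) →L[ℂ] C(K, ℂ))) : Set (ProbabilityMeasure K) :=
  {μ | (μ : Measure K).Regular ∧
    ∀ T ∈ 𝒮, ∀ f : C(K, ℂ), ∫ x, T f x ∂(μ : Measure K) = ∫ x, f x ∂(μ : Measure K)}

/-- The semigroup `𝒮_μ` of all operators on `L¹(K, μ)` induced by some `T ∈ 𝒮`, that is, of the
continuous linear operators sending the class of `f` to the class of `T f` for all `f ∈ C(K)`. -/
def inducedSemigroup (𝒮 : Set (C(K, ℂ) →L[ℂ] C(K, ℂ))) (μ : ProbabilityMeasure K) :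
    Set (Lp ℂ 1 (μ : Measure K) →L[ℂ] Lp ℂ 1 (μ : Measure K)) :=
  {R | ∃ T ∈ 𝒮, ∀ f : C(K, ℂ),
    R (ContinuousMap.toLp 1 (μ : Measure K) ℂ f) = ContinuousMap.toLp 1 (μ : Measure K) ℂ (T f)}

/-- The fixed space of `𝒮_μ` in `L¹(K, μ)`. -/
def fixedSpace (𝒮 : Set (C(K, ℂ) →L[ℂ] C(K, ℂ))) (μ : ProbabilityMeasure K) :
    Submodule ℂ (Lp ℂ 1 (μ : Measure K)) where
  carrier := {g | ∀ R ∈ inducedSemigroup 𝒮 μ, R g = g}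
  add_mem' := by
    intro f g hf hg R hR
    rw [map_add, hf R hR, hg R hR]
  zero_mem' := by
    intro R _
    exact map_zero R
  smul_mem' := by
    intro c f hf R hR
    rw [map_smul, hf R hR]

/-- The ergodic measures: invariant measures `μ` for which the fixed space of `𝒮_μ` in `L¹(K, μ)`
is one-dimensional. -/
def ergodicMeasures (𝒮 : Set (C(K, ℂ) →L[ℂ] C(K, ℂ))) : Set (ProbabilityMeasure K) :=
  {μ | μ ∈ invariantMeasures 𝒮 ∧ Module.finrank ℂ (fixedSpace 𝒮 μ) = 1}


/-- Continuous functions on `K` have integrable absolute value. -/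
theorem integrable_norm_continuousMap (μ : ProbabilityMeasure K) (f : C(K, ℂ)) :
    Integrable (fun x => ‖f x‖) (μ : Measure K) :=
  (f.continuous.norm).integrable_of_hasCompactSupport (HasCompactSupport.of_compactSpace _)

/-- The absolute kernel `I_μ = {f | ⟨|f|, μ⟩ = 0}` of `μ`. -/
def absoluteKernel (μ : ProbabilityMeasure K) : Ideal C(K, ℂ) where
  carrier := {f | ∫ x, ‖f x‖ ∂(μ : Measure K) = 0}
  add_mem' := by
    intro f g hf hg
    refine le_antisymm ?_ (integral_nonneg fun x => norm_nonneg _)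
    calc ∫ x, ‖(f + g) x‖ ∂(μ : Measure K)
        ≤ ∫ x, (‖f x‖ + ‖g x‖) ∂(μ : Measure K) :=
          integral_mono (integrable_norm_continuousMap μ (f + g))
            ((integrable_norm_continuousMap μ f).add (integrable_norm_continuousMap μ g))
            fun x => norm_add_le _ _
      _ = ∫ x, ‖f x‖ ∂(μ : Measure K) + ∫ x, ‖g x‖ ∂(μ : Measure K) :=
          integral_add (integrable_norm_continuousMap μ f) (integrable_norm_continuousMap μ g)
      _ = 0 := by rw [show ∫ x, ‖f x‖ ∂(μ : Measure K) = 0 from hf,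
                    show ∫ x, ‖g x‖ ∂(μ : Measure K) = 0 from hg, add_zero]
  zero_mem' := by simp
  smul_mem' := by
    intro c f hf
    refine le_antisymm ?_ (integral_nonneg fun x => norm_nonneg _)
    calc ∫ x, ‖(c • f) x‖ ∂(μ : Measure K)
        ≤ ∫ x, ‖c‖ * ‖f x‖ ∂(μ : Measure K) := by
          refine integral_mono (integrable_norm_continuousMap μ (c • f))
            ((integrable_norm_continuousMap μ f).const_mul _) fun x => ?_
          simp only [smul_eq_mul, ContinuousMap.mul_apply, norm_mul]
          exact mul_le_mul_of_nonneg_right (c.norm_coe_le_norm x) (norm_nonneg _)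
      _ = ‖c‖ * ∫ x, ‖f x‖ ∂(μ : Measure K) := integral_const_mul _ _
      _ = 0 := by rw [show ∫ x, ‖f x‖ ∂(μ : Measure K) = 0 from hf, mul_zero]

/-- The primitive spectrum `Prim(𝒮)`: the `𝒮`-ideals that are absolute kernels of ergodic
measures. -/
def primitiveSpectrum (𝒮 : Set (C(K, ℂ) →L[ℂ] C(K, ℂ))) : Set (Ideal C(K, ℂ)) :=
  {p | IsSIdeal 𝒮 p ∧ ∃ μ ∈ ergodicMeasures 𝒮, p = absoluteKernel μ}

/-- The `𝒮`-radical of a subset `I` of `C(K)`: the intersection of all primitive `𝒮`-ideals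
containing `I` (and `C(K)` if there are none). -/
def sRadical (𝒮 : Set (C(K, ℂ) →L[ℂ] C(K, ℂ))) (I : Set C(K, ℂ)) : Ideal C(K, ℂ) :=
  sInf {p | p ∈ primitiveSpectrum 𝒮 ∧ I ⊆ p}

/-- A non-empty closed set `L` is self-supporting if for all `x ∈ L` and `T ∈ 𝒮` the measure
`T'δ_x`, i.e. the regular Borel measure representing `f ↦ (T f)(x)`, has support in `L`. -/
structure IsSelfSupporting (𝒮 : Set (C(K, ℂ) →L[ℂ] C(K, ℂ))) (L : Set K) : Prop where
  isClosed : IsClosed L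
  nonempty : L.Nonempty
  support_subset : ∀ T ∈ 𝒮, ∀ x ∈ L, ∃ ν : ProbabilityMeasure K, (ν : Measure K).Regular ∧
    (∀ f : C(K, ℂ), ∫ y, f y ∂(ν : Measure K) = T f x) ∧ (ν : Measure K).support ⊆ L

/-- `L` is the support of the `𝒮`-ideal `I`: the (unique) self-supporting set with `I_L = I`. -/
structure IsIdealSupport (𝒮 : Set (C(K, ℂ) →L[ℂ] C(K, ℂ))) (I : Ideal C(K, ℂ)) (L : Set K) :
    Prop where
  isSIdeal : IsSIdeal 𝒮 I
  isSelfSupporting : IsSelfSupporting 𝒮 L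
  vanishingIdeal_eq : vanishingIdeal L = I

end MarkovSemigroups

section SemigroupActions

/-- The Koopman operator `T_s f (x) = f (s x)` on `C(K)`. -/
def koopmanOperator {M K : Type*} [TopologicalSpace M] [TopologicalSpace K] [CompactSpace K]
    [SMul M K] [ContinuousSMul M K] (s : M) : C(K, ℂ) →L[ℂ] C(K, ℂ) where
  toFun f := f.comp ⟨fun x => s • x, continuous_const_smul s⟩
  map_add' _ _ := rfl
  map_smul' _ _ := rfl
  cont := ContinuousMap.continuous_precomp _

/-- The Koopman semigroup `{T_s | s ∈ M}`. -/
def koopmanSemigroup (M K : Type*) [TopologicalSpace M] [TopologicalSpace K] [CompactSpace K]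
    [SMul M K] [ContinuousSMul M K] : Set (C(K, ℂ) →L[ℂ] C(K, ℂ)) :=
  Set.range fun s : M => (koopmanOperator s : C(K, ℂ) →L[ℂ] C(K, ℂ))

variable {G : Type*} [Group G] [TopologicalSpace G] [MeasurableSpace G]

/-- `F` is a Følner sequence for the subsemigroup `S` of `G` with respect to the measure `m`. -/
structure IsFolnerSequence (m : Measure G) (S : Subsemigroup G) (F : ℕ → Set G) : Prop where
  isCompact : ∀ n, IsCompact (F n)
  subset : ∀ n, F n ⊆ (S : Set G)
  measure_pos : ∀ n, 0 < m (F n)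
  tendsto : ∀ s ∈ S, Tendsto (fun n => m (F n ∆ (s • F n)) / m (F n)) atTop (𝓝 0)

/-- `L` is a (global) center of attraction with respect to the sequence `F`. -/
structure IsCenterOfAttraction (m : Measure G) (S : Subsemigroup G) (F : ℕ → Set G)
    {K : Type*} [TopologicalSpace K] [SMul S K] (L : Set K) : Prop where
  isClosed : IsClosed L
  nonempty : L.Nonempty
  tendsto : ∀ U : Set K, IsOpen U → L ⊆ U → ∀ x : K,
    Tendsto (fun n => m ((↑) '' {s : S | (s : G) ∈ F n ∧ s • x ∈ U}) / m (F n)) atTop (𝓝 1)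

end SemigroupActions

end

/-! Everything reduces to one criterion: a non-empty closed `L` is a center of attraction iff it
contains the support of every ergodic measure. The right-hand side does not mention the Følner
sequence. Since `I_μ` is the ideal of functions vanishing on the support of `μ`, the radical is the
ideal of the closure of the union of these supports, and inclusions of such ideals reverse
inclusions of closed sets; all three claims follow.

Sufficiency: if `L` contains all the supports but mass escapes an open `U ⊇ L` along the orbit of
`x`, take a Urysohn function `f` that is 0 on `L` and 1 off `U`. Its orbit averages at `x` are
frequently at least some `ε > 0`, and a cluster point of the averaging functionals is an invariant
state `φ` with `φ f ≥ ε` (`exists_mem_invariantStates_le`). By Krein–Milman the face of invariant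
states maximizing `f` has an extreme point; it is ergodic
(`mem_ergodicMeasures_of_mem_extremePoints`), yet its support meets `{f ≠ 0}`, a contradiction.

Necessity: averaging over `F n` preserves the integral against an invariant measure. If `0 ≤ f ≤ 1`
vanishes on a center of attraction, its averages tend to 0 pointwise, so `∫ f = 0` by dominated
convergence and `f` vanishes on the support (`IsCenterOfAttraction.support_subset`). -/

/-! ### Ideals of functions vanishing on a set; absolute kernels and supports. -/

section VanishingIdeals

variable {K : Type*} [TopologicalSpace K] [CompactSpace K]

omit [CompactSpace K] in
theorem mem_vanishingIdeal {L : Set K} {f : C(K, ℂ)} :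
    f ∈ vanishingIdeal L ↔ ∀ x ∈ L, f x = 0 := Iff.rfl

/-- Urysohn's lemma separates the closed set `L` from a point of `L'` outside it; `L'` need not be
closed. -/
theorem vanishingIdeal_le_iff [T2Space K] {L L' : Set K} (hL : IsClosed L) :
    vanishingIdeal L ≤ vanishingIdeal L' ↔ L' ⊆ L := by
  refine ⟨fun h x hx => ?_, fun h f hf x hx => hf x (h hx)⟩
  by_contra hxL
  obtain ⟨g, hg0, hg1, -⟩ := exists_continuous_zero_one_of_isClosed hL isClosed_singleton
    (Set.disjoint_singleton_right.2 hxL)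
  have hf : (⟨fun y => (g y : ℂ), by fun_prop⟩ : C(K, ℂ)) ∈ vanishingIdeal L := fun y hy => by
    simp [hg0 hy]
  have := h hf x hx
  simp [hg1 (Set.mem_singleton x)] at this

omit [CompactSpace K] in
theorem isClosed_vanishingIdeal (L : Set K) : IsClosed (vanishingIdeal L : Set C(K, ℂ)) := by
  have : (vanishingIdeal L : Set C(K, ℂ)) = ⋂ x ∈ L, {f : C(K, ℂ) | f x = 0} := by
    ext f
    simp [mem_vanishingIdeal]
  rw [this]
  exact isClosed_biInter fun x _ => isClosed_eq (continuous_eval_const x) continuous_const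

theorem isSIdeal_vanishingIdeal {M : Type*} [TopologicalSpace M] [SMul M K] [ContinuousSMul M K]
    {L : Set K} (hne : L.Nonempty) (hinv : ∀ (s : M), ∀ x ∈ L, s • x ∈ L) :
    IsSIdeal (koopmanSemigroup M K) (vanishingIdeal L) where
  isClosed := isClosed_vanishingIdeal L
  ne_top h := by
    obtain ⟨x, hx⟩ := hne
    simpa using mem_vanishingIdeal.1 ((Ideal.eq_top_iff_one _).1 h) x hx
  invariant := by
    rintro _ ⟨s, rfl⟩ f hf x hx
    exact hf _ (hinv s x hx)

variable [MeasurableSpace K] [BorelSpace K]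

theorem integrable_continuousMap {E : Type*} [NormedAddCommGroup E] (μ : Measure K)
    [IsFiniteMeasure μ] (f : C(K, E)) : Integrable f μ :=
  f.continuous.integrable_of_hasCompactSupport (HasCompactSupport.of_compactSpace _)

/-- The zero set of a continuous function is closed, so it contains the support as soon as it is
conull. Conversely, regularity makes the support itself conull. -/
theorem absoluteKernel_eq_vanishingIdeal_support (μ : ProbabilityMeasure K)
    [(μ : Measure K).Regular] : absoluteKernel μ = vanishingIdeal (μ : Measure K).support := by
  ext f
  have h1 : f ∈ absoluteKernel μ ↔ (fun x => ‖f x‖) =ᵐ[(μ : Measure K)] 0 :=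
    integral_eq_zero_iff_of_nonneg (fun x => norm_nonneg _) (integrable_norm_continuousMap μ f)
  rw [h1, mem_vanishingIdeal]
  constructor
  · intro h x hx
    have hcl : IsClosed {x | f x = 0} := isClosed_eq f.continuous continuous_const
    refine Measure.support_subset_of_isClosed hcl ?_ hx
    filter_upwards [h] with y hy
    simpa using hy
  · intro h
    filter_upwards [Measure.support_mem_ae_of_regular (μ := (μ : Measure K))] with x hx
    simp [h x hx]

omit [CompactSpace K] [BorelSpace K] in
theorem support_nonempty_of_regular (μ : ProbabilityMeasure K) [(μ : Measure K).Regular] :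
    (μ : Measure K).support.Nonempty := by
  by_contra h
  have h1 := Measure.measure_compl_support_of_regular (μ := (μ : Measure K))
  rw [Set.not_nonempty_iff_eq_empty.1 h, Set.compl_empty, measure_univ] at h1
  exact one_ne_zero h1

end VanishingIdeals

/-! ### Invariant measures, invariance of their supports, and the radical of zero. -/

section InvariantMeasures

variable {K : Type*} [TopologicalSpace K] [CompactSpace K] [T2Space K]
  [MeasurableSpace K] [BorelSpace K]

theorem ext_of_integral_continuousMap_eq {μ ν : Measure K} [μ.Regular] [ν.Regular]
    (h : ∀ f : C(K, ℝ), ∫ x, f x ∂μ = ∫ x, f x ∂ν) : μ = ν :=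
  Measure.ext_of_integral_eq_on_compactlySupported fun f => h f

variable {M : Type*} [TopologicalSpace M] [SMul M K] [ContinuousSMul M K]

omit [T2Space K] in
theorem mem_invariantMeasures_iff (μ : ProbabilityMeasure K) [(μ : Measure K).Regular] :
    μ ∈ invariantMeasures (koopmanSemigroup M K) ↔
      ∀ (s : M) (f : C(K, ℝ)), ∫ x, f (s • x) ∂(μ : Measure K) = ∫ x, f x ∂(μ : Measure K) := by
  constructor
  · intro h s f
    have := h.2 _ ⟨s, rfl⟩ ⟨fun y => (f y : ℂ), by fun_prop⟩
    simp only [koopmanOperator, ContinuousLinearMap.coe_mk', LinearMap.coe_mk, AddHom.coe_mk,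
      ContinuousMap.comp_apply, ContinuousMap.coe_mk] at this
    rw [integral_complex_ofReal, integral_complex_ofReal] at this
    exact_mod_cast this
  · refine fun h => ⟨inferInstance, ?_⟩
    rintro _ ⟨s, rfl⟩ f
    have hi : ∀ f : C(K, ℂ), Integrable f (μ : Measure K) := integrable_continuousMap _
    have hre := h s ⟨fun y => (f y).re, by fun_prop⟩
    have him := h s ⟨fun y => (f y).im, by fun_prop⟩
    have e1 := integral_re_add_im (𝕜 := ℂ) (hi f)
    have e2 := integral_re_add_im (𝕜 := ℂ) (hi (koopmanOperator s f))
    rw [← e1, ← e2]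
    exact congrArg₂ (fun a b : ℝ => (a : ℂ) + b * Complex.I) hre him

theorem measurePreserving_smul {μ : ProbabilityMeasure K}
    (hμ : μ ∈ invariantMeasures (koopmanSemigroup M K)) (s : M) :
    MeasurePreserving (fun x : K => s • x) (μ : Measure K) (μ : Measure K) := by
  have := hμ.1
  have hc : Continuous fun x : K => s • x := continuous_const_smul s
  refine ⟨hc.measurable, ?_⟩
  -- Uniqueness in the Riesz theorem needs the pushforward to be regular; inner regularity passes to
  -- continuous images.
  have : Measure.InnerRegularCompactLTTop (Measure.map (fun x : K => s • x) (μ : Measure K)) :=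
    Measure.InnerRegularCompactLTTop.map_of_continuous hc
  refine ext_of_integral_continuousMap_eq fun f => ?_
  rw [integral_map hc.aemeasurable f.continuous.aestronglyMeasurable]
  exact (mem_invariantMeasures_iff μ).1 hμ s f

/-- The preimage of the support under `s` is closed and conull, hence contains the support. -/
theorem smul_mem_support {μ : ProbabilityMeasure K}
    (hμ : μ ∈ invariantMeasures (koopmanSemigroup M K)) (s : M) {x : K}
    (hx : x ∈ (μ : Measure K).support) : s • x ∈ (μ : Measure K).support := by
  have := hμ.1
  have hcl : IsClosed ((fun x : K => s • x) ⁻¹' (μ : Measure K).support) :=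
    Measure.isClosed_support.preimage (continuous_const_smul s)
  exact Measure.support_subset_of_isClosed hcl ((measurePreserving_smul hμ s).quasiMeasurePreserving
    |>.tendsto_ae Measure.support_mem_ae_of_regular) hx

theorem absoluteKernel_mem_primitiveSpectrum {μ : ProbabilityMeasure K}
    (hμ : μ ∈ ergodicMeasures (koopmanSemigroup M K)) :
    absoluteKernel μ ∈ primitiveSpectrum (koopmanSemigroup M K) := by
  have := hμ.1.1
  refine ⟨?_, μ, hμ, rfl⟩
  rw [absoluteKernel_eq_vanishingIdeal_support]
  exact isSIdeal_vanishingIdeal (support_nonempty_of_regular μ) fun s x => smul_mem_support hμ.1 s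

theorem sRadical_zero_eq_vanishingIdeal :
    sRadical (koopmanSemigroup M K) {0} = vanishingIdeal
      (closure (⋃ μ ∈ ergodicMeasures (koopmanSemigroup M K), (μ : Measure K).support)) := by
  refine le_antisymm (fun f hf => ?_) (le_sInf ?_)
  · have hsub : (⋃ μ ∈ ergodicMeasures (koopmanSemigroup M K), (μ : Measure K).support) ⊆
        {x | f x = 0} := by
      refine Set.iUnion₂_subset fun μ hμ x hx => ?_
      have := hμ.1.1
      have hfμ : f ∈ absoluteKernel μ := (sInf_le (a := absoluteKernel μ)
        ⟨absoluteKernel_mem_primitiveSpectrum hμ, by simp⟩ : sRadical _ _ ≤ _) hf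
      rw [absoluteKernel_eq_vanishingIdeal_support] at hfμ
      exact hfμ x hx
    exact fun x hx => closure_minimal hsub (isClosed_eq f.continuous continuous_const) hx
  · rintro p ⟨⟨-, μ, hμ, rfl⟩, -⟩
    have := hμ.1.1
    rw [absoluteKernel_eq_vanishingIdeal_support, vanishingIdeal_le_iff isClosed_closure]
    exact (Set.subset_biUnion_of_mem (u := fun μ : ProbabilityMeasure K => (μ : Measure K).support)
      hμ).trans subset_closure

theorem vanishingIdeal_le_sRadical_zero_iff {L : Set K} (hL : IsClosed L) :
    vanishingIdeal L ≤ sRadical (koopmanSemigroup M K) {0} ↔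
      ∀ μ ∈ ergodicMeasures (koopmanSemigroup M K), (μ : Measure K).support ⊆ L := by
  rw [sRadical_zero_eq_vanishingIdeal, vanishingIdeal_le_iff hL, hL.closure_subset_iff,
    Set.iUnion₂_subset_iff]

omit [CompactSpace K] [T2Space K] in
/-- A Dirac measure at `x` has support in every closed set containing `x`. -/
theorem support_dirac_subset {L : Set K} (hL : IsClosed L) {x : K} (hx : x ∈ L) :
    (Measure.dirac x).support ⊆ L :=
  Measure.support_subset_of_isClosed hL
    ((mem_ae_dirac_iff hL.measurableSet).2 hx)

omit [CompactSpace K] in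
theorem regular_dirac (x : K) : (Measure.dirac x).Regular := by
  have : (Measure.dirac x).InnerRegular := ⟨fun U hU r hr => by
    by_cases hx : x ∈ U
    · exact ⟨{x}, by simpa, isCompact_singleton, by
        rw [Measure.dirac_apply_of_mem hx] at hr
        rwa [Measure.dirac_apply_of_mem (Set.mem_singleton x)]⟩
    · rw [Measure.dirac_apply' _ hU, Set.indicator_of_notMem hx] at hr
      exact absurd hr not_lt_zero⟩
  infer_instance

theorem isSelfSupporting_of_smul_mem {L : Set K} (hL : IsClosed L) (hne : L.Nonempty)
    (hinv : ∀ (s : M), ∀ x ∈ L, s • x ∈ L) :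
    IsSelfSupporting (koopmanSemigroup M K) L where
  isClosed := hL
  nonempty := hne
  support_subset := by
    rintro _ ⟨s, rfl⟩ x hx
    refine ⟨⟨Measure.dirac (s • x), inferInstance⟩, regular_dirac _, fun f => ?_,
      support_dirac_subset hL (hinv s x hx)⟩
    exact integral_dirac _ _

end InvariantMeasures

/-! ### Invariant states: compactness, extreme points and ergodicity. -/

noncomputable section States

variable {K : Type*} [TopologicalSpace K] [CompactSpace K]

variable (K) in
/-- The state space of `C(K, ℝ)`. -/
def states : Set (WeakDual ℝ C(K, ℝ)) :=
  {φ | (∀ f : C(K, ℝ), 0 ≤ f → 0 ≤ φ f) ∧ φ 1 = 1}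

/-- Banach–Alaoglu: the states are weak-* closed and lie in the unit ball. -/
theorem isCompact_states : IsCompact (states K) := by
  refine (WeakDual.isCompact_closedBall (𝕜 := ℝ) (E := C(K, ℝ)) 0 1).of_isClosed_subset ?_ ?_
  · have : states K = (⋂ (f : C(K, ℝ)) (_ : 0 ≤ f), {φ : WeakDual ℝ C(K, ℝ) | 0 ≤ φ f}) ∩
        {φ | φ 1 = 1} := by
      ext φ
      simp [states]
    rw [this]
    exact (isClosed_biInter fun f _ => isClosed_le continuous_const (WeakDual.eval_continuous f)).inter
      (isClosed_eq (WeakDual.eval_continuous 1) continuous_const)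
  · rintro φ ⟨hpos, hone⟩
    rw [Set.mem_preimage, mem_closedBall_zero_iff]
    refine ContinuousLinearMap.opNorm_le_bound _ zero_le_one fun f => ?_
    -- Positivity on `‖f‖ • 1 - g`, used for `g = f` and `g = -f`, gives `|φ f| ≤ ‖f‖`.
    have key : ∀ g : C(K, ℝ), ‖g‖ = ‖f‖ → φ g ≤ ‖f‖ := fun g hg => by
      have h := hpos (‖f‖ • 1 - g) fun x => by
        simpa using (le_abs_self (g x)).trans ((g.norm_coe_le_norm x).trans hg.le)
      rw [map_sub, map_smul, hone, smul_eq_mul, mul_one] at h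
      linarith
    have h2 := key (-f) (norm_neg f)
    rw [map_neg] at h2
    rw [one_mul, Real.norm_eq_abs]
    exact abs_le.2 ⟨neg_le.1 h2, key f rfl⟩

variable (M K : Type*) [TopologicalSpace M] [TopologicalSpace K] [CompactSpace K] [SMul M K]
  [ContinuousSMul M K] in
/-- The states of `C(K, ℝ)` that are invariant under the Koopman semigroup. -/
def invariantStates : Set (WeakDual ℝ C(K, ℝ)) :=
  {φ | φ ∈ states K ∧
    ∀ (s : M) (f : C(K, ℝ)), φ (f.comp ⟨fun x => s • x, continuous_const_smul s⟩) = φ f}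

variable {M : Type*} [TopologicalSpace M] [SMul M K] [ContinuousSMul M K]

theorem isCompact_invariantStates : IsCompact (invariantStates M K) := by
  have : invariantStates M K = states K ∩ ⋂ (s : M) (f : C(K, ℝ)), {φ : WeakDual ℝ C(K, ℝ) |
      φ (f.comp ⟨fun x => s • x, continuous_const_smul s⟩) = φ f} := by
    ext φ
    simp [invariantStates]
  rw [this]
  exact isCompact_states.inter_right (isClosed_iInter fun s => isClosed_iInter fun f =>
    isClosed_eq (WeakDual.eval_continuous _) (WeakDual.eval_continuous f))

variable [MeasurableSpace K] [BorelSpace K]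

/-- Integration against a finite measure as a functional on `C(K, ℝ)`. -/
def integralFunctional (μ : Measure K) [IsFiniteMeasure μ] : WeakDual ℝ C(K, ℝ) :=
  StrongDual.toWeakDual (LinearMap.mkContinuous
    { toFun := fun f : C(K, ℝ) => ∫ x, f x ∂μ
      map_add' := fun f g =>
        integral_add (integrable_continuousMap μ f) (integrable_continuousMap μ g)
      map_smul' := fun c f => integral_const_mul c f } (μ.real Set.univ) fun f => by
        refine (norm_integral_le_of_norm_le_const (μ := μ) (C := ‖f‖)
          (.of_forall fun x => f.norm_coe_le_norm x)).trans (mul_comm _ _).le)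

@[simp]
theorem integralFunctional_apply (μ : Measure K) [IsFiniteMeasure μ] (f : C(K, ℝ)) :
    integralFunctional μ f = ∫ x, f x ∂μ := rfl

theorem integralFunctional_mem_states (μ : Measure K) [IsProbabilityMeasure μ] :
    integralFunctional μ ∈ states K :=
  ⟨fun _ hf => integral_nonneg hf, by simp⟩

theorem exists_regular_measure_of_mem_states [T2Space K] {φ : WeakDual ℝ C(K, ℝ)}
    (hφ : φ ∈ states K) : ∃ μ : ProbabilityMeasure K, (μ : Measure K).Regular ∧
      integralFunctional (μ : Measure K) = φ := by
  let Λ : CompactlySupportedContinuousMap K ℝ →ₚ[ℝ] ℝ :=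
    { toFun := fun f => φ (f : C(K, ℝ))
      map_add' := fun f g => map_add φ (f : C(K, ℝ)) (g : C(K, ℝ))
      map_smul' := fun c f => map_smul φ c (f : C(K, ℝ))
      monotone' := fun f g hfg => by
        have h := hφ.1 ((g : C(K, ℝ)) - (f : C(K, ℝ))) fun x => sub_nonneg.2 (hfg x)
        rw [map_sub] at h
        exact sub_nonneg.1 h }
  have hΛ : ∀ f : C(K, ℝ), ∫ x, f x ∂(RealRMK.rieszMeasure Λ) = φ f := fun f =>
    RealRMK.integral_rieszMeasure Λ (CompactlySupportedContinuousMap.continuousMapEquiv f)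
  have hp : IsProbabilityMeasure (RealRMK.rieszMeasure Λ) := by
    have h1 := hΛ 1
    rw [hφ.2] at h1
    simp only [ContinuousMap.one_apply, integral_const, smul_eq_mul, mul_one] at h1
    exact ⟨(ENNReal.toReal_eq_one_iff _).1 h1⟩
  refine ⟨⟨_, hp⟩, (inferInstance : (RealRMK.rieszMeasure Λ).Regular), ?_⟩
  exact DFunLike.ext _ _ hΛ

theorem integralFunctional_mem_invariantStates_iff (μ : ProbabilityMeasure K)
    [(μ : Measure K).Regular] : integralFunctional (μ : Measure K) ∈ invariantStates M K ↔
      μ ∈ invariantMeasures (koopmanSemigroup M K) := by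
  rw [mem_invariantMeasures_iff]
  exact ⟨fun h => h.2, fun h => ⟨integralFunctional_mem_states _, h⟩⟩

theorem integralFunctional_cond_mem_invariantStates [T2Space K] {μ : ProbabilityMeasure K}
    (hμ : μ ∈ invariantMeasures (koopmanSemigroup M K)) {A : Set K} (hA : MeasurableSet A)
    (hpos : (μ : Measure K) A ≠ 0)
    (hinv : ∀ s : M, (fun x : K => s • x) ⁻¹' A =ᵐ[(μ : Measure K)] A) :
    integralFunctional (ProbabilityTheory.cond (μ : Measure K) A) ∈ invariantStates M K := by
  have := ProbabilityTheory.cond_isProbabilityMeasure hpos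
  refine ⟨integralFunctional_mem_states _, fun s f => ?_⟩
  have hmp := (measurePreserving_smul hμ s).restrict_preimage hA
  rw [Measure.restrict_congr_set (hinv s)] at hmp
  simp only [integralFunctional_apply, ProbabilityTheory.cond, integral_smul_measure]
  congr 1
  conv_rhs => rw [← hmp.map_eq]
  rw [integral_map hmp.measurable.aemeasurable f.continuous.aestronglyMeasurable]
  rfl

/-- Otherwise `μ` is a proper convex combination of its conditionings on `A` and `Aᶜ`, both
invariant. Extremality makes the conditioning on `A` equal to `μ`, although it gives `Aᶜ` mass zero.
-/
theorem ae_mem_or_ae_notMem_of_mem_extremePoints [T2Space K] {μ : ProbabilityMeasure K}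
    [(μ : Measure K).Regular]
    (hμ : integralFunctional (μ : Measure K) ∈ (invariantStates M K).extremePoints ℝ)
    {A : Set K} (hA : MeasurableSet A)
    (hinv : ∀ s : M, (fun x : K => s • x) ⁻¹' A =ᵐ[(μ : Measure K)] A) :
    (∀ᵐ x ∂(μ : Measure K), x ∈ A) ∨ ∀ᵐ x ∂(μ : Measure K), x ∉ A := by
  have hμi := (integralFunctional_mem_invariantStates_iff μ).1 hμ.1
  by_contra! h
  obtain ⟨hAc, hA0⟩ := h
  have hA0 : (μ : Measure K) A ≠ 0 := fun h => hA0 (measure_eq_zero_iff_ae_notMem.1 h)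
  have hAc' : (μ : Measure K) Aᶜ ≠ 0 := fun h => hAc (by simpa using measure_eq_zero_iff_ae_notMem.1 h)
  have h1 := integralFunctional_cond_mem_invariantStates hμi hA hA0 hinv
  have h2 := integralFunctional_cond_mem_invariantStates hμi hA.compl hAc' fun s =>
    (hinv s).compl
  have hr1 : 0 < (μ : Measure K).real A := ENNReal.toReal_pos hA0 (measure_ne_top _ _)
  have hr2 : 0 < (μ : Measure K).real Aᶜ := ENNReal.toReal_pos hAc' (measure_ne_top _ _)
  have hseg : integralFunctional (μ : Measure K) ∈ openSegment ℝ
      (integralFunctional (ProbabilityTheory.cond (μ : Measure K) A))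
      (integralFunctional (ProbabilityTheory.cond (μ : Measure K) Aᶜ)) := by
    refine ⟨_, _, hr1, hr2, ?_, ?_⟩
    · simpa using measureReal_add_measureReal_compl (μ := (μ : Measure K)) hA
    · refine DFunLike.ext _ _ fun f => ?_
      have hi := integral_add_compl hA (integrable_continuousMap (μ : Measure K) f)
      change (μ : Measure K).real A * ∫ x, f x ∂(ProbabilityTheory.cond (μ : Measure K) A) +
        (μ : Measure K).real Aᶜ * ∫ x, f x ∂(ProbabilityTheory.cond (μ : Measure K) Aᶜ) =
          ∫ x, f x ∂(μ : Measure K)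
      rw [← hi]
      simp only [ProbabilityTheory.cond, integral_smul_measure, ENNReal.toReal_inv, smul_eq_mul,
        ← measureReal_def]
      rw [mul_inv_cancel_left₀ hr1.ne', mul_inv_cancel_left₀ hr2.ne']
  have heq := hμ.2 h1 h2 hseg
  have : (ProbabilityTheory.cond (μ : Measure K) A).InnerRegularCompactLTTop :=
    Measure.InnerRegularCompactLTTop.smul _
  have heq' : ProbabilityTheory.cond (μ : Measure K) A = μ :=
    ext_of_integral_continuousMap_eq fun f => congrArg (fun φ : WeakDual ℝ C(K, ℝ) => φ f) heq
  apply hAc'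
  rw [← heq', ProbabilityTheory.cond_apply hA]
  simp

/-- The preimage of a Borel set under a fixed function is almost invariant, hence null or conull, so
the function is a.e. constant. -/
theorem mem_ergodicMeasures_of_mem_extremePoints [T2Space K] {μ : ProbabilityMeasure K}
    [(μ : Measure K).Regular]
    (hμ : integralFunctional (μ : Measure K) ∈ (invariantStates M K).extremePoints ℝ) :
    μ ∈ ergodicMeasures (koopmanSemigroup M K) := by
  have hμi := (integralFunctional_mem_invariantStates_iff μ).1 hμ.1
  refine ⟨hμi, ?_⟩
  have hone : ContinuousMap.toLp 1 (μ : Measure K) ℂ (1 : C(K, ℂ)) ∈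
      fixedSpace (koopmanSemigroup M K) μ := by
    rintro R ⟨_, ⟨s, rfl⟩, hR⟩
    rw [hR]
    rfl
  have hcoe := ContinuousMap.coeFn_toLp (p := 1) (𝕜 := ℂ) (μ : Measure K) (1 : C(K, ℂ))
  refine (finrank_eq_one_iff_of_nonzero' (⟨_, hone⟩ : fixedSpace (koopmanSemigroup M K) μ) ?_).2 ?_
  · intro h0
    have h0' : ContinuousMap.toLp 1 (μ : Measure K) ℂ (1 : C(K, ℂ)) = 0 := congrArg Subtype.val h0
    rw [h0'] at hcoe
    have := hcoe.symm.trans (Lp.coeFn_zero ℂ 1 (μ : Measure K))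
    obtain ⟨x, hx⟩ := this.exists
    simp at hx
  · rintro ⟨g, hg⟩
    have hfix : ∀ s : M, (fun x => g (s • x)) =ᵐ[(μ : Measure K)] g := fun s => by
      have hmp := measurePreserving_smul hμi s
      -- Composition with `s` is an isometry of `L¹` and belongs to the induced semigroup, so being
      -- fixed by it is a.e. invariance under `s`.
      let R := (Lp.compMeasurePreservingₗᵢ ℂ (E := ℂ) (p := 1) (fun x : K => s • x)
        hmp).toContinuousLinearMap
      have hR : R ∈ inducedSemigroup (koopmanSemigroup M K) μ := by
        refine ⟨_, ⟨s, rfl⟩, fun f => Lp.ext ?_⟩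
        have e1 := Lp.coeFn_compMeasurePreserving (ContinuousMap.toLp 1 (μ : Measure K) ℂ f) hmp
        have e2 := hmp.quasiMeasurePreserving.ae_eq_comp
          (ContinuousMap.coeFn_toLp (p := 1) (𝕜 := ℂ) (μ : Measure K) f)
        exact (e1.trans e2).trans (ContinuousMap.coeFn_toLp (p := 1) (𝕜 := ℂ) (μ : Measure K)
          (koopmanOperator s f)).symm
      have hRg : Lp.compMeasurePreserving _ hmp g = g := hg R hR
      have e1 := Lp.coeFn_compMeasurePreserving g hmp
      rw [hRg] at e1
      exact e1.symm
    obtain ⟨c, hc⟩ : ∃ c : ℂ, (g : K → ℂ) =ᵐ[(μ : Measure K)] Function.const K c :=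
      exists_eventuallyEq_const_of_forall_separating MeasurableSet fun U hU =>
        ae_mem_or_ae_notMem_of_mem_extremePoints hμ
          ((Lp.stronglyMeasurable g).measurable hU) fun s => by
            filter_upwards [hfix s] with x hx
            exact congrArg (fun z => z ∈ U) hx
    refine ⟨c, Subtype.ext (Lp.ext ?_)⟩
    filter_upwards [hc, hcoe, Lp.coeFn_smul c (ContinuousMap.toLp 1 (μ : Measure K) ℂ
      (1 : C(K, ℂ)))] with x h1 h2 h3
    rw [h1]
    refine h3.trans ?_
    rw [Pi.smul_apply, h2, ContinuousMap.one_apply, smul_eq_mul, mul_one, Function.const_apply]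

/-- The mean of a continuous function under an invariant state is at most its mean under some
ergodic measure. -/
theorem exists_mem_ergodicMeasures_le_integral [T2Space K] {φ : WeakDual ℝ C(K, ℝ)}
    (hφ : φ ∈ invariantStates M K) (f : C(K, ℝ)) :
    ∃ μ ∈ ergodicMeasures (koopmanSemigroup M K), φ f ≤ ∫ x, f x ∂(μ : Measure K) := by
  let ev : StrongDual ℝ (WeakDual ℝ C(K, ℝ)) :=
    ⟨{ toFun := fun ψ => ψ f
       map_add' := fun _ _ => rfl
       map_smul' := fun _ _ => rfl }, WeakDual.eval_continuous f⟩
  have hP := isCompact_invariantStates (M := M) (K := K)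
  obtain ⟨ψ₀, hψ₀, hmax⟩ := hP.exists_isMaxOn ⟨φ, hφ⟩ (WeakDual.eval_continuous f).continuousOn
  -- The maximizers of `f` form an exposed face, so an extreme point of this face is extreme among
  -- all invariant states.
  have hexp : IsExposed ℝ (invariantStates M K) (ev.toExposed (invariantStates M K)) :=
    ContinuousLinearMap.toExposed.isExposed
  have : LocallyConvexSpace ℝ (WeakDual ℝ C(K, ℝ)) :=
    inferInstanceAs (LocallyConvexSpace ℝ (WeakBilin (topDualPairing ℝ C(K, ℝ))))
  obtain ⟨ψ, hψ⟩ := (hexp.isCompact hP).extremePoints_nonempty ⟨ψ₀, hψ₀, fun χ hχ => hmax hχ⟩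
  obtain ⟨μ, hreg, rfl⟩ := exists_regular_measure_of_mem_states hψ.1.1.1
  exact ⟨μ, mem_ergodicMeasures_of_mem_extremePoints
    (hexp.isExtreme.extremePoints_subset_extremePoints hψ), hψ.1.2 φ hφ⟩

end States

/-! ### Orbit averages over compact sets and their invariant limits. -/

section FolnerAverages

variable {G : Type*} [Group G] [TopologicalSpace G] (S : Subsemigroup G)
  {K : Type*} [TopologicalSpace K] [SemigroupAction S K] [ContinuousSMul S K]

open Classical in
/-- The action of `S` on `K`, extended to all of `G` by letting the elements outside `S` act
trivially. -/
noncomputable def extendedSMul (g : G) : C(K, K) :=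
  if hg : g ∈ S then ⟨fun x => (⟨g, hg⟩ : S) • x, continuous_const_smul _⟩ else ContinuousMap.id K

variable {S}

theorem extendedSMul_coe (s : S) (x : K) : extendedSMul S (s : G) x = s • x := by
  simp [extendedSMul]

theorem extendedSMul_mul {g h : G} (hg : g ∈ S) (hh : h ∈ S) (x : K) :
    extendedSMul S (g * h) x = extendedSMul S g (extendedSMul S h x) := by
  lift g to S using hg
  lift h to S using hh
  rw [← MulMemClass.coe_mul, extendedSMul_coe, extendedSMul_coe, extendedSMul_coe, mul_smul]

theorem continuousOn_extendedSMul_apply (x : K) :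
    ContinuousOn (fun g : G => extendedSMul S g x) S := by
  rw [continuousOn_iff_continuous_domRestrict]
  have : (S : Set G).domRestrict (fun g : G => extendedSMul S g x) = fun s : S => s • x :=
    funext fun s => extendedSMul_coe s x
  rw [this]
  fun_prop

/-- Currying the jointly continuous `f (s • x)` gives norm continuity in `s`, so these functions can
be integrated with values in `C(K, ℝ)`. -/
theorem continuousOn_comp_extendedSMul (f : C(K, ℝ)) :
    ContinuousOn (fun g : G => f.comp (extendedSMul S g)) S := by
  rw [continuousOn_iff_continuous_domRestrict]
  let F : C(S × K, ℝ) := ⟨fun p => f (p.1 • p.2), by fun_prop⟩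
  have : (S : Set G).domRestrict (fun g : G => f.comp (extendedSMul S g)) = F.curry := by
    funext s
    ext x
    exact congrArg f (extendedSMul_coe s x)
  rw [this]
  exact F.curry.continuous

variable [T2Space G] [MeasurableSpace G] [BorelSpace G] [MeasurableSpace K] [BorelSpace K]
  (m : Measure G)

variable (S) in
/-- The distribution of `s • x` when `s` is chosen at random in `A` according to `m`. -/
noncomputable def orbitMeasure (A : Set G) (x : K) : Measure K :=
  (ProbabilityTheory.cond m A).map fun g => extendedSMul S g x

variable {m} {A : Set G}

theorem aemeasurable_extendedSMul_cond (hA : IsCompact A) (hAS : A ⊆ S) (x : K) :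
    AEMeasurable (fun g => extendedSMul S g x) (ProbabilityTheory.cond m A) :=
  (((continuousOn_extendedSMul_apply x).mono hAS).aemeasurable hA.measurableSet).smul_measure _

theorem isProbabilityMeasure_orbitMeasure [IsFiniteMeasureOnCompacts m] (hA : IsCompact A)
    (hAS : A ⊆ S) (hpos : 0 < m A) (x : K) : IsProbabilityMeasure (orbitMeasure S m A x) := by
  have := ProbabilityTheory.cond_isProbabilityMeasure_of_finite hpos.ne' hA.measure_lt_top.ne
  exact Measure.isProbabilityMeasure_map (aemeasurable_extendedSMul_cond hA hAS x)

theorem integral_orbitMeasure (hA : IsCompact A) (hAS : A ⊆ S) (x : K) (f : C(K, ℝ)) :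
    ∫ y, f y ∂(orbitMeasure S m A x) =
      (m.real A)⁻¹ * ∫ g in A, f (extendedSMul S g x) ∂m := by
  rw [orbitMeasure, integral_map (aemeasurable_extendedSMul_cond hA hAS x)
    f.continuous.aestronglyMeasurable, ProbabilityTheory.cond, integral_smul_measure,
    ENNReal.toReal_inv, smul_eq_mul, measureReal_def]

theorem orbitMeasure_apply (hA : IsCompact A) (hAS : A ⊆ S) (x : K) {U : Set K}
    (hU : MeasurableSet U) : orbitMeasure S m A x U =
      m ((↑) '' {s : S | (s : G) ∈ A ∧ s • x ∈ U}) / m A := by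
  rw [orbitMeasure, Measure.map_apply_of_aemeasurable (aemeasurable_extendedSMul_cond hA hAS x) hU,
    ProbabilityTheory.cond_apply hA.measurableSet, ENNReal.div_eq_inv_mul]
  congr 2
  ext g
  constructor
  · rintro ⟨hg, hgx⟩
    refine ⟨⟨g, hAS hg⟩, ⟨hg, ?_⟩, rfl⟩
    rwa [← extendedSMul_coe]
  · rintro ⟨s, ⟨hs, hsx⟩, rfl⟩
    refine ⟨hs, ?_⟩
    rwa [Set.mem_preimage, extendedSMul_coe]

omit [MeasurableSpace K] [BorelSpace K] in
theorem integrableOn_comp_extendedSMul [IsFiniteMeasureOnCompacts m] (hA : IsCompact A)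
    (hAS : A ⊆ S) (x : K) (f : C(K, ℝ)) :
    IntegrableOn (fun g => f (extendedSMul S g x)) A m :=
  (f.continuous.comp_continuousOn
    ((continuousOn_extendedSMul_apply x).mono hAS)).integrableOn_compact hA

theorem abs_setIntegral_sub_setIntegral_le {α : Type*} [MeasurableSpace α] {μ : Measure α}
    {h : α → ℝ} {A B : Set α} (hA : MeasurableSet A) (hB : MeasurableSet B)
    (hμA : μ A ≠ ⊤) (hμB : μ B ≠ ⊤) (hiA : IntegrableOn h A μ) (hiB : IntegrableOn h B μ)
    {C : ℝ} (hC : ∀ x, |h x| ≤ C) :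
    |∫ x in B, h x ∂μ - ∫ x in A, h x ∂μ| ≤ C * μ.real (A ∆ B) := by
  -- The integrals over `A ∩ B` cancel; only the two set differences remain.
  rw [← integral_inter_add_sdiff hB hiA, ← integral_inter_add_sdiff hA hiB, Set.inter_comm B A,
    add_sub_add_left_eq_sub, Set.symmDiff_def,
    measureReal_union disjoint_sdiff_sdiff (hB.diff hA)
      (measure_ne_top_of_subset Set.sdiff_subset hμA)
      (measure_ne_top_of_subset Set.sdiff_subset hμB), mul_add, add_comm]
  have hb : ∀ D : Set α, μ D ≠ ⊤ → |∫ x in D, h x ∂μ| ≤ C * μ.real D := fun D hD =>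
    norm_setIntegral_le_of_norm_le_const (f := h) hD.lt_top fun x _ => hC x
  exact (abs_sub _ _).trans (add_le_add
    (hb _ (measure_ne_top_of_subset Set.sdiff_subset hμB))
    (hb _ (measure_ne_top_of_subset Set.sdiff_subset hμA)))

variable [IsTopologicalGroup G] [CompactSpace K] [m.IsHaarMeasure]

/-- Left invariance of Haar measure turns the translate by `t` into an average over `t • A`, which
differs from that over `A` only on the symmetric difference. -/
theorem abs_integral_smul_orbitMeasure_sub_le (hA : IsCompact A) (hAS : A ⊆ S) (x : K)
    (f : C(K, ℝ)) (t : S) :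
    |∫ y, f (t • y) ∂(orbitMeasure S m A x) - ∫ y, f y ∂(orbitMeasure S m A x)| ≤
      ‖f‖ * (m (A ∆ ((t : G) • A)) / m A).toReal := by
  have hB : IsCompact ((t : G) • A) := hA.smul (t : G)
  have hBS : (t : G) • A ⊆ S := by
    rintro _ ⟨a, ha, rfl⟩
    exact S.mul_mem t.2 (hAS ha)
  have e1 := integral_orbitMeasure (m := m) hA hAS x (f.comp ⟨fun y => t • y,
    continuous_const_smul t⟩)
  simp only [ContinuousMap.comp_apply, ContinuousMap.coe_mk] at e1
  have e2 : ∫ g in A, f (t • extendedSMul S g x) ∂m =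
      ∫ g in (t : G) • A, f (extendedSMul S g x) ∂m := by
    have hmap := (measurableEmbedding_mulLeft (t : G)).setIntegral_map (μ := m)
      (fun g => f (extendedSMul S g x)) ((t : G) • A)
    rw [map_mul_left_eq_self] at hmap
    rw [hmap, show (fun g => (t : G) * g) ⁻¹' ((t : G) • A) = A from
      (Set.preimage_image_eq A (mul_right_injective (t : G)))]
    refine setIntegral_congr_fun hA.measurableSet fun g hg => ?_
    simp only [extendedSMul_mul t.2 (hAS hg), extendedSMul_coe]
  rw [e1, e2, integral_orbitMeasure hA hAS, ← mul_sub, abs_mul, abs_inv,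
    abs_of_nonneg measureReal_nonneg, ENNReal.toReal_div, div_eq_inv_mul, mul_left_comm]
  refine mul_le_mul_of_nonneg_left ?_ (inv_nonneg.2 measureReal_nonneg)
  exact abs_setIntegral_sub_setIntegral_le hA.measurableSet hB.measurableSet hA.measure_lt_top.ne
    hB.measure_lt_top.ne (integrableOn_comp_extendedSMul hA hAS x f)
    (integrableOn_comp_extendedSMul hB hBS x f) fun g => f.norm_coe_le_norm _

-- The average is a Bochner integral in `C(K, ℝ)`; it commutes with point evaluations and with `φ`,
-- so no Fubini argument on `G × K` is needed.
omit [IsTopologicalGroup G] in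
theorem exists_average_eq_integral_orbitMeasure (hA : IsCompact A) (hAS : A ⊆ S) (hpos : 0 < m A)
    {φ : WeakDual ℝ C(K, ℝ)} (hφ : φ ∈ invariantStates S K) (f : C(K, ℝ)) :
    ∃ a : C(K, ℝ), (∀ x, a x = ∫ y, f y ∂(orbitMeasure S m A x)) ∧ φ a = φ f := by
  have hint : IntegrableOn (fun g : G => f.comp (extendedSMul S g)) A m :=
    ((continuousOn_comp_extendedSMul f).mono hAS).integrableOn_compact hA
  refine ⟨(m.real A)⁻¹ • ∫ g in A, f.comp (extendedSMul S g) ∂m, fun x => ?_, ?_⟩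
  · rw [integral_orbitMeasure hA hAS, ContinuousMap.smul_apply, smul_eq_mul]
    congr 1
    exact ((ContinuousMap.evalCLM ℝ x).integral_comp_comm hint).symm
  · have h1 : φ (∫ g in A, f.comp (extendedSMul S g) ∂m) = ∫ g in A, φ f ∂m := by
      refine ((WeakDual.toStrongDual φ).integral_comp_comm hint).symm.trans
        (setIntegral_congr_fun hA.measurableSet fun g hg => ?_)
      have : f.comp (extendedSMul S g) = f.comp ⟨fun x => (⟨g, hAS hg⟩ : S) • x,
          continuous_const_smul _⟩ := by
        ext x
        exact congrArg f (extendedSMul_coe (⟨g, hAS hg⟩ : S) x)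
      change φ (f.comp (extendedSMul S g)) = φ f
      rw [this, hφ.2]
    rw [map_smul, h1, setIntegral_const, smul_smul, inv_mul_cancel₀, one_smul]
    exact (ENNReal.toReal_pos hpos.ne' hA.measure_lt_top.ne).ne'

variable {F : ℕ → Set G}

theorem exists_mem_invariantStates_le (hF : IsFolnerSequence m S F) {x : K} {f : C(K, ℝ)} {ε : ℝ}
    (h : ∃ᶠ n in atTop, ε ≤ ∫ y, f y ∂(orbitMeasure S m (F n) x)) :
    ∃ φ ∈ invariantStates S K, ε ≤ φ f := by
  have hprob : ∀ n, IsProbabilityMeasure (orbitMeasure S m (F n) x) := fun n =>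
    isProbabilityMeasure_orbitMeasure (hF.isCompact n) (hF.subset n) (hF.measure_pos n) x
  let φ : ℕ → WeakDual ℝ C(K, ℝ) := fun n => integralFunctional (orbitMeasure S m (F n) x)
  -- An ultrafilter finer than `l` sees only indices where the lower bound holds, and still tends to
  -- infinity, so the Følner condition applies.
  let l : Filter ℕ := atTop ⊓ 𝓟 {n | ε ≤ ∫ y, f y ∂(orbitMeasure S m (F n) x)}
  have : l.NeBot := frequently_iff_neBot.1 h
  let u := Ultrafilter.of l
  have hul : (u : Filter ℕ) ≤ l := Ultrafilter.of_le l
  obtain ⟨ψ, hψ, hlim⟩ := isCompact_states.ultrafilter_le_nhds' (u.map φ)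
    (Eventually.of_forall fun n => integralFunctional_mem_states _ : ∀ᶠ n in u, φ n ∈ states K)
  have hlim' : ∀ g : C(K, ℝ), Tendsto (fun n => φ n g) u (𝓝 (ψ g)) := fun g =>
    ((WeakDual.eval_continuous g).tendsto ψ).comp hlim
  refine ⟨ψ, ⟨hψ, fun s g => ?_⟩, ge_of_tendsto (hlim' f) ?_⟩
  · have h0 : Tendsto (fun n => ‖g‖ * (m (F n ∆ ((s : G) • F n)) / m (F n)).toReal) u (𝓝 0) := by
      have := (ENNReal.tendsto_toReal ENNReal.zero_ne_top).comp
        ((hF.tendsto s s.2).mono_left (hul.trans inf_le_left))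
      simpa using this.const_mul ‖g‖
    have h1 : Tendsto (fun n => φ n (g.comp ⟨fun x => s • x, continuous_const_smul s⟩) - φ n g)
        u (𝓝 0) :=
      squeeze_zero_norm (fun n => abs_integral_smul_orbitMeasure_sub_le (hF.isCompact n)
        (hF.subset n) x g s) h0
    exact sub_eq_zero.1 (tendsto_nhds_unique ((hlim' _).sub (hlim' g)) h1)
  · exact (hul.trans inf_le_right) (mem_principal_self _)

end FolnerAverages

/-! ### Centers of attraction and supports of invariant measures. -/

section CentersOfAttraction

variable {G : Type*} [Group G] [TopologicalSpace G] [IsTopologicalGroup G] [T2Space G]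
  [MeasurableSpace G] [BorelSpace G] {m : Measure G} [m.IsHaarMeasure] {S : Subsemigroup G}
  {K : Type*} [TopologicalSpace K] [CompactSpace K] [T2Space K]
  [MeasurableSpace K] [BorelSpace K] [SemigroupAction S K] [ContinuousSMul S K]
  {F : ℕ → Set G}

theorem exists_mem_ergodicMeasures [Nonempty K] (hF : IsFolnerSequence m S F) :
    (ergodicMeasures (koopmanSemigroup S K)).Nonempty := by
  obtain ⟨x⟩ := ‹Nonempty K›
  obtain ⟨φ, hφ, -⟩ := exists_mem_invariantStates_le hF (x := x) (f := (0 : C(K, ℝ))) (ε := 0)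
    (Frequently.of_forall fun n => by simp)
  obtain ⟨μ, hμ, -⟩ := exists_mem_ergodicMeasures_le_integral hφ 0
  exact ⟨μ, hμ⟩

theorem isCenterOfAttraction_of_support_subset (hF : IsFolnerSequence m S F) {L : Set K}
    (hL : IsClosed L) (hne : L.Nonempty)
    (h : ∀ μ ∈ ergodicMeasures (koopmanSemigroup S K), (μ : Measure K).support ⊆ L) :
    IsCenterOfAttraction m S F L := by
  refine ⟨hL, hne, fun U hU hLU x => ?_⟩
  have hprob : ∀ n, IsProbabilityMeasure (orbitMeasure S m (F n) x) := fun n =>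
    isProbabilityMeasure_orbitMeasure (hF.isCompact n) (hF.subset n) (hF.measure_pos n) x
  simp_rw [← fun n => orbitMeasure_apply (m := m) (hF.isCompact n) (hF.subset n) x
    hU.measurableSet]
  refine tendsto_order.2 ⟨fun a ha => ?_, fun a ha => .of_forall fun n => prob_le_one.trans_lt ha⟩
  by_contra hfreq
  obtain ⟨f, hf0, hf1, hf01⟩ := exists_continuous_zero_one_of_isClosed hL hU.isClosed_compl
    (Set.disjoint_compl_right_iff_subset.2 hLU)
  -- Whenever `U` has mass at most `a < 1`, its complement, where `f = 1`, has mass at least `1 -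
  -- a`.
  have hfreq' : ∃ᶠ n in atTop, 1 - a.toReal ≤ ∫ y, f y ∂(orbitMeasure S m (F n) x) := by
    refine (not_eventually.1 hfreq).mono fun n hn => ?_
    have h1 : (orbitMeasure S m (F n) x).real U ≤ a.toReal :=
      ENNReal.toReal_mono ha.ne_top (not_lt.1 hn)
    have h2 : (orbitMeasure S m (F n) x).real Uᶜ ≤ ∫ y, f y ∂(orbitMeasure S m (F n) x) := by
      rw [← integral_indicator_one hU.measurableSet.compl]
      refine integral_mono ((integrable_const (1 : ℝ)).indicator hU.measurableSet.compl)
        (integrable_continuousMap _ f) fun y => ?_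
      by_cases hy : y ∈ Uᶜ
      · rw [Set.indicator_of_mem hy, hf1 hy]
      · rw [Set.indicator_of_notMem hy]
        exact (hf01 y).1
    rw [probReal_compl_eq_one_sub hU.measurableSet] at h2
    linarith
  obtain ⟨φ, hφ, hφf⟩ := exists_mem_invariantStates_le hF hfreq'
  obtain ⟨μ, hμ, hμf⟩ := exists_mem_ergodicMeasures_le_integral hφ f
  have := hμ.1.1
  have hzero : ∫ y, f y ∂(μ : Measure K) = 0 := by
    refine integral_eq_zero_of_ae ?_
    filter_upwards [Measure.support_mem_ae_of_regular (μ := (μ : Measure K))] with y hy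
    exact hf0 (h μ hμ hy)
  have ha' : a.toReal < 1 := by
    simpa using (ENNReal.toReal_lt_toReal ha.ne_top ENNReal.one_ne_top).2 ha
  linarith

omit [IsTopologicalGroup G] [T2Space K] in
/-- The averages of a nonnegative function vanishing on a center of attraction tend to zero. -/
theorem IsCenterOfAttraction.tendsto_integral_orbitMeasure (hF : IsFolnerSequence m S F)
    {L : Set K} (h : IsCenterOfAttraction m S F L) {f : C(K, ℝ)} (hf0 : ∀ x ∈ L, f x = 0)
    (hf01 : ∀ x, f x ∈ Set.Icc (0 : ℝ) 1) (x : K) :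
    Tendsto (fun n => ∫ y, f y ∂(orbitMeasure S m (F n) x)) atTop (𝓝 0) := by
  have hprob : ∀ n, IsProbabilityMeasure (orbitMeasure S m (F n) x) := fun n =>
    isProbabilityMeasure_orbitMeasure (hF.isCompact n) (hF.subset n) (hF.measure_pos n) x
  refine tendsto_order.2 ⟨fun a ha => .of_forall fun n =>
    ha.trans_le (integral_nonneg fun y => (hf01 y).1), fun ε hε => ?_⟩
  -- The set `{f < ε / 2}` is an open neighbourhood of `L`, and `f` is at most `ε / 2` plus the
  -- indicator of its complement, whose mass is eventually below `ε / 2`.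
  have hU : IsOpen {y | f y < ε / 2} := isOpen_lt f.continuous continuous_const
  have hlim := h.tendsto _ hU (fun y hy => by simpa [hf0 y hy] using hε) x
  simp_rw [← fun n => orbitMeasure_apply (m := m) (hF.isCompact n) (hF.subset n) x
    hU.measurableSet] at hlim
  have hlim' := (ENNReal.tendsto_toReal ENNReal.one_ne_top).comp hlim
  filter_upwards [hlim'.eventually (lt_mem_nhds (b := (1 : ENNReal).toReal) (a := 1 - ε / 2)
    (by simpa using hε))] with n hn
  have h1 : ∫ y, f y ∂(orbitMeasure S m (F n) x) ≤
      ∫ y, (ε / 2 + {y | f y < ε / 2}ᶜ.indicator 1 y) ∂(orbitMeasure S m (F n) x) := by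
    have hi := (integrable_const (μ := orbitMeasure S m (F n) x) (1 : ℝ)).indicator
      hU.measurableSet.compl
    refine integral_mono (integrable_continuousMap _ f) ((integrable_const _).add hi) fun y => ?_
    by_cases hy : f y < ε / 2
    · rw [Set.indicator_of_notMem (by simpa using hy)]
      linarith
    · rw [Set.indicator_of_mem (by simpa using hy)]
      have := (hf01 y).2
      simp only [Pi.one_apply]
      linarith
  rw [integral_add (g := {y | f y < ε / 2}ᶜ.indicator 1) (integrable_const _)
    ((integrable_const (1 : ℝ)).indicator hU.measurableSet.compl),
    integral_indicator_one hU.measurableSet.compl,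
    probReal_compl_eq_one_sub hU.measurableSet] at h1
  simp only [integral_const, probReal_univ, smul_eq_mul, one_mul] at h1
  simp only [Function.comp_apply, ← measureReal_def] at hn
  linarith

theorem IsCenterOfAttraction.support_subset (hF : IsFolnerSequence m S F) {L : Set K}
    (h : IsCenterOfAttraction m S F L) {μ : ProbabilityMeasure K}
    (hμ : μ ∈ invariantMeasures (koopmanSemigroup S K)) : (μ : Measure K).support ⊆ L := by
  intro x hx
  by_contra hxL
  have := hμ.1
  obtain ⟨f, hf0, hf1, hf01⟩ := exists_continuous_zero_one_of_isClosed h.isClosed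
    isClosed_singleton (Set.disjoint_singleton_right.2 hxL)
  have hφ := (integralFunctional_mem_invariantStates_iff μ).2 hμ
  -- Each `a n` is the continuous function of `F n`-averages of `f`, with the same `μ`-integral as
  -- `f`.
  choose a ha haf using fun n => exists_average_eq_integral_orbitMeasure (hF.isCompact n) (hF.subset n)
    (hF.measure_pos n) hφ f
  simp only [integralFunctional_apply] at haf
  have hlim : Tendsto (fun n => ∫ y, a n y ∂(μ : Measure K)) atTop
      (𝓝 (∫ _, (0 : ℝ) ∂(μ : Measure K))) := by
    refine tendsto_integral_of_dominated_convergence (fun _ => 1)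
      (fun n => (a n).continuous.aestronglyMeasurable) (integrable_const 1)
      (fun n => .of_forall fun y => ?_) (.of_forall fun y => ?_)
    · have := isProbabilityMeasure_orbitMeasure (hF.isCompact n) (hF.subset n)
        (hF.measure_pos n) y
      rw [ha]
      refine (norm_integral_le_of_norm_le_const (C := 1) (.of_forall fun z => ?_)).trans ?_
      · rw [Real.norm_eq_abs, abs_of_nonneg (hf01 z).1]
        exact (hf01 z).2
      · simp
    · simp_rw [ha]
      exact h.tendsto_integral_orbitMeasure hF (fun z hz => hf0 hz) hf01 y
  simp_rw [haf, integral_zero] at hlim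
  have hzero : ∫ y, f y ∂(μ : Measure K) = 0 := tendsto_nhds_unique tendsto_const_nhds hlim
  rw [integral_eq_zero_iff_of_nonneg (fun y => (hf01 y).1) (integrable_continuousMap _ f)] at hzero
  have hcl : IsClosed {y | f y = 0} := isClosed_eq f.continuous continuous_const
  have hfx : f x = 0 := Measure.support_subset_of_isClosed hcl hzero hx
  rw [hf1 (Set.mem_singleton x)] at hfx
  exact one_ne_zero hfx

theorem isCenterOfAttraction_iff (hF : IsFolnerSequence m S F) {L : Set K} (hL : IsClosed L)
    (hne : L.Nonempty) : IsCenterOfAttraction m S F L ↔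
      vanishingIdeal L ≤ sRadical (koopmanSemigroup S K) {0} := by
  rw [vanishingIdeal_le_sRadical_zero_iff hL]
  exact ⟨fun h _ hμ => h.support_subset hF hμ.1, isCenterOfAttraction_of_support_subset hF hL hne⟩

end CentersOfAttraction

/-! ### The main theorem. -/

theorem theorem4p5
    {G : Type*} [Group G] [TopologicalSpace G] [IsTopologicalGroup G] [LocallyCompactSpace G]
    [T2Space G] [MeasurableSpace G] [BorelSpace G]
    (m : Measure G) [m.IsHaarMeasure]
    (S : Subsemigroup G) (hS : IsClosed (S : Set G))
    {K : Type*} [TopologicalSpace K] [CompactSpace K] [T2Space K] [Nonempty K]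
    [MeasurableSpace K] [BorelSpace K]
    [SemigroupAction S K] [ContinuousSMul S K]
    (F : ℕ → Set G) (hF : IsFolnerSequence m S F) :
    -- the notion of a center of attraction does not depend on the sequence
    (∀ F' : ℕ → Set G, IsFolnerSequence m S F' → ∀ L : Set K,
      (IsCenterOfAttraction m S F' L ↔ IsCenterOfAttraction m S F L)) ∧
    -- characterization of centers of attraction
    (∀ L : Set K, IsClosed L → L.Nonempty →
      (IsCenterOfAttraction m S F L ↔
        vanishingIdeal L ≤ sRadical (koopmanSemigroup S K) {0})) ∧
    -- the closure of the union of the supports of ergodic measures is the least center of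
    -- attraction, the unique minimal one, and the support of the radical of the zero ideal
    (∀ M : Set K,
      M = closure (⋃ μ ∈ ergodicMeasures (koopmanSemigroup S K), (μ : Measure K).support) →
      IsLeast {L : Set K | IsCenterOfAttraction m S F L} M ∧
      (∀ L : Set K, Minimal (IsCenterOfAttraction m S F) L ↔ L = M) ∧
      IsIdealSupport (koopmanSemigroup S K) (sRadical (koopmanSemigroup S K) {0}) M) := by
  refine ⟨fun F' hF' L => ?_, fun L => isCenterOfAttraction_iff hF, ?_⟩
  · exact ⟨fun h => (isCenterOfAttraction_iff hF h.isClosed h.nonempty).2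
        ((isCenterOfAttraction_iff hF' h.isClosed h.nonempty).1 h),
      fun h => (isCenterOfAttraction_iff hF' h.isClosed h.nonempty).2
        ((isCenterOfAttraction_iff hF h.isClosed h.nonempty).1 h)⟩
  rintro M rfl
  set U := ⋃ μ ∈ ergodicMeasures (koopmanSemigroup S K), (μ : Measure K).support with hU
  have hne : (closure U).Nonempty := by
    obtain ⟨μ, hμ⟩ := exists_mem_ergodicMeasures (K := K) hF
    have := hμ.1.1
    obtain ⟨x, hx⟩ := support_nonempty_of_regular μ
    exact ⟨x, subset_closure (Set.mem_biUnion hμ hx)⟩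
  -- Each support is invariant, hence so is their union, and its closure by continuity.
  have hinv : ∀ (s : S), ∀ x ∈ closure U, s • x ∈ closure U := by
    refine fun s => (Set.MapsTo.closure (fun x hx => ?_) (continuous_const_smul s) :
      Set.MapsTo (fun x : K => s • x) (closure U) (closure U))
    obtain ⟨μ, hμ, hxμ⟩ := Set.mem_iUnion₂.1 hx
    exact Set.mem_biUnion hμ (smul_mem_support hμ.1 s hxμ)
  have hrad : sRadical (koopmanSemigroup S K) {0} = vanishingIdeal (closure U) :=
    sRadical_zero_eq_vanishingIdeal
  have hleast : IsLeast {L : Set K | IsCenterOfAttraction m S F L} (closure U) :=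
    ⟨(isCenterOfAttraction_iff hF isClosed_closure hne).2 hrad.ge, fun L hL =>
      (vanishingIdeal_le_iff hL.isClosed).1
        (((isCenterOfAttraction_iff hF hL.isClosed hL.nonempty).1 hL).trans hrad.le)⟩
  refine ⟨hleast, fun L => hleast.minimal_iff, ?_⟩
  rw [hrad]
  exact ⟨isSIdeal_vanishingIdeal hne hinv,
    isSelfSupporting_of_smul_mem isClosed_closure hne hinv, rfl⟩
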